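/- Let $\mathbb{F}$ be a field, let $m\ge 0$, and let $K$ be an abstract simplicial complex with vertex set $[m]=\{1,\dots,m\}$: a family of subsets of $[m]$, closed under passing to subsets, that contains $\varnothing$ and every singleton $\{v\}$, $v\in[m]$ (for $m=0$, $K=\{\varnothing\}$). Let $\mathrm{mdim}(K)$ be the minimum of $\dim\sigma=|\sigma|-1$ over the inclusion-maximal simplices $\sigma$ of $K$. Let $S=\mathbb{F}[v_1,\dots,v_m]$, let $\mathbb{F}[K]=S/\mathcal{I}_K$ be the Stanley–Reisner ring, where $\mathcal{I}_K$ is generated by the squarefree monomials $\prod_{i\in\sigma}v_i$ with $\sigma\subseteq[m]$, $\sigma\notin K$, and regard $\mathbb{F}$ as the $S$-module on which every $v_i$ acts as $0$. For $i\ge 0$ put $\beta^{-i}(\mathbb{F}[K])=\dim_{\mathbb{F}}\mathrm{Tor}^S_i(\mathbb{F}[K],\mathbb{F})$. Call $K$ weakly tight (over $\mathbb{F}$) if $$\sum_{i\ge 0}\beta^{-i}(\mathbb{F}[K])=2^{\,m-\mathrm{mdim}(K)-1}.$$ If $K$ is weakly tight over $\mathbb{F}$, then $$\beta^{-i}(\mathbb{F}[K])=\binom{m-\mathrm{mdim}(K)-1}{i}\qquad\text{for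 every } 0\le i\le m-\mathrm{mdim}(K)-1,$$ and the projective dimension of $\mathbb{F}[K]$ as an $S$-module is $\mathrm{pdim}(\mathbb{F}[K])=m-\mathrm{mdim}(K)-1$. -/

import Mathlib

open CategoryTheory

noncomputable section

universe u

namespace AbstractSimplicialComplex

variable {m : ℕ}

/-- All simplices of `K`, including the empty one. (`K.faces` holds the nonempty simplices.)
For `m = 0` this is the irrelevant complex `{∅}`. -/
def simplices (K : AbstractSimplicialComplex (Fin m)) : Set (Finset (Fin m)) :=
  insert ∅ K.faces

/-- The maximal simplices of `K` with respect to inclusion. -/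
def maximalSimplices (K : AbstractSimplicialComplex (Fin m)) : Set (Finset (Fin m)) :=
  {σ | Maximal (· ∈ K.simplices) σ}

/-- The minimal dimension of the maximal simplices of `K`, where `dim σ = |σ| - 1`.
It is `-1` for the irrelevant complex `{∅}`. -/
def mdim (K : AbstractSimplicialComplex (Fin m)) : ℤ :=
  sInf {d : ℤ | ∃ σ ∈ K.maximalSimplices, d = (σ.card : ℤ) - 1}

/-- The minimum in the definition of `mdim` is attained. -/
theorem mdim_mem (K : AbstractSimplicialComplex (Fin m)) :
    ∃ σ ∈ K.maximalSimplices, K.mdim = (σ.card : ℤ) - 1 := by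
  have hne : {d : ℤ | ∃ σ ∈ K.maximalSimplices, d = (σ.card : ℤ) - 1}.Nonempty := by
    obtain ⟨σ, hσ⟩ := (Set.toFinite K.simplices).exists_maximal ⟨∅, Or.inl rfl⟩
    exact ⟨_, σ, hσ, rfl⟩
  have hbd : BddBelow {d : ℤ | ∃ σ ∈ K.maximalSimplices, d = (σ.card : ℤ) - 1} := by
    refine ⟨-1, ?_⟩
    rintro d ⟨σ, -, rfl⟩
    omega
  exact Int.csInf_mem hne hbd

/-- `m - mdim K - 1 ≥ 0`, so passing to natural numbers with `Int.toNat` loses nothing. -/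
theorem coe_toNat_sub_mdim (K : AbstractSimplicialComplex (Fin m)) :
    (((m : ℤ) - K.mdim - 1).toNat : ℤ) = (m : ℤ) - K.mdim - 1 := by
  obtain ⟨σ, -, h⟩ := K.mdim_mem
  have := card_finset_fin_le σ
  omega

variable (F : Type u) [Field F]

/-- The Stanley-Reisner ideal, generated by the squarefree monomials of the non-simplices. -/
def stanleyReisnerIdeal (K : AbstractSimplicialComplex (Fin m)) :
    Ideal (MvPolynomial (Fin m) F) :=
  Ideal.span {p | ∃ σ : Finset (Fin m), σ ∉ K.simplices ∧ p = ∏ i ∈ σ, MvPolynomial.X i}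

/-- The Stanley-Reisner ring `F[K]`. -/
abbrev StanleyReisnerRing (K : AbstractSimplicialComplex (Fin m)) : Type u :=
  MvPolynomial (Fin m) F ⧸ K.stanleyReisnerIdeal F

/-- `F[K]` as a module over the polynomial ring. -/
def stanleyReisnerModule (K : AbstractSimplicialComplex (Fin m)) :
    ModuleCat.{u} (MvPolynomial (Fin m) F) :=
  ModuleCat.of _ (K.StanleyReisnerRing F)

variable (m) in
/-- `F` as the trivial module over the polynomial ring: every variable acts as zero. -/
def trivialModule : ModuleCat.{u} (MvPolynomial (Fin m) F) :=
  (ModuleCat.restrictScalars (MvPolynomial.constantCoeff (σ := Fin m) (R := F))).obj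
    (ModuleCat.of F F)

/-- `Tor_i (F[K], F)` over the polynomial ring, regarded as a vector space over `F`. -/
def torSpace (K : AbstractSimplicialComplex (Fin m)) (i : ℕ) : ModuleCat.{u} F :=
  (ModuleCat.restrictScalars (MvPolynomial.C (σ := Fin m) (R := F))).obj
    (((Tor (ModuleCat.{u} (MvPolynomial (Fin m) F)) i).obj (K.stanleyReisnerModule F)).obj
      (trivialModule m F))

/-- The `i`-th Betti number `β^{-i}(F[K])`: the dimension over `F` of `Tor_i (F[K], F)`,
in all internal degrees together. -/
def bettiNumber (K : AbstractSimplicialComplex (Fin m)) (i : ℕ) : ℕ∞ :=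
  Cardinal.toENat (Module.rank F (K.torSpace F i))

/-- The total Betti number of `F[K]`. -/
def totalBettiNumber (K : AbstractSimplicialComplex (Fin m)) : ℕ∞ :=
  ∑' i : ℕ, K.bettiNumber F i

/-- Every series in `ℕ∞` converges, so `totalBettiNumber` is a genuine sum. -/
theorem hasSum_bettiNumber (K : AbstractSimplicialComplex (Fin m)) :
    HasSum (K.bettiNumber F) (K.totalBettiNumber F) :=
  Summable.hasSum ⟨_, tendsto_atTop_iSup fun _ _ h => Finset.sum_le_sum_of_subset h⟩

/-- `K` is weakly tight over `F` if its total Betti number is `2 ^ (m - mdim K - 1)`. -/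
def IsWeaklyTight (K : AbstractSimplicialComplex (Fin m)) : Prop :=
  K.totalBettiNumber F = 2 ^ ((m : ℤ) - K.mdim - 1).toNat

/-- The projective dimension of `F[K]` over the polynomial ring. -/
def pdim (K : AbstractSimplicialComplex (Fin m)) : WithBot ℕ∞ :=
  projectiveDimension (K.stanleyReisnerModule F)

end AbstractSimplicialComplex

end

/-! The core is the termwise bound `choose_le_bettiNumber`: for every maximal simplex σ and n = m -
|σ|, the i-th Betti number is at least binom(n, i). Apply it to a σ of dimension mdim(K). Since the
binomials sum to 2^n, weak tightness makes every inequality an equality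
(`ENat.eq_choose_of_tsum_eq`). Then Tor_n is nonzero and Tor_{n+1} vanishes, which pins down the
projective dimension.

For the bound, let A be the residue field at the indicator vector of σ. The variety of F[K] is a
union of coordinate subspaces, and near this point it is just the one spanned by σ, because σ is
maximal. Algebraically, x_σ = ∏_{i∈σ} X_i kills the kernel of F[K] → S/(X_j : j ∉ σ) but acts as 1
on A. So Tor_i(F[K], A) surjects onto Tor_i(S/(X_j : j ∉ σ), A), which has dimension binom(n, i) by
a Koszul computation (`choose_le_length_tor`, `length_tor_quotient_span_X`).

It remains to move from that point to the origin. F[K] is graded, hence has a minimal graded free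
resolution. Its ranks are the Betti numbers at the origin, and they bound the Tor dimensions at
every point (`length_tor_le`). The resolution is never built as a whole: one minimal cover at a time
suffices, by induction on syzygies. -/

noncomputable section

open CategoryTheory

/-! ### Tor of modules: long exact sequence in the first argument, scalar actions, vanishing -/

namespace ModuleTor

variable {R : Type u} [CommRing R]

/-- `Tor_n (M, A)` with the arguments in the order of `CategoryTheory.Tor`. -/
abbrev tor (n : ℕ) (M A : ModuleCat.{u} R) : ModuleCat.{u} R :=
  ((Tor (ModuleCat.{u} R) n).obj M).obj A

/-- The map on `Tor_n` induced by a map of the first argument. -/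
abbrev torMap (n : ℕ) {M N : ModuleCat.{u} R} (f : M ⟶ N) (A : ModuleCat.{u} R) :
    tor n M A ⟶ tor n N A :=
  ((Tor (ModuleCat.{u} R) n).map f).app A

/-- The complex `M ⊗ P` for a projective resolution `P` of `A`. -/
abbrev tensorComplex (M : ModuleCat.{u} R) {A : ModuleCat.{u} R} (P : ProjectiveResolution A) :
    ChainComplex (ModuleCat.{u} R) ℕ :=
  (((MonoidalCategory.tensoringLeft (ModuleCat.{u} R)).obj M).mapHomologicalComplex _).obj P.complex

abbrev tensorComplexMap {M N : ModuleCat.{u} R} (f : M ⟶ N) {A : ModuleCat.{u} R}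
    (P : ProjectiveResolution A) : tensorComplex M P ⟶ tensorComplex N P :=
  (NatTrans.mapHomologicalComplex
    ((MonoidalCategory.tensoringLeft (ModuleCat.{u} R)).map f) _).app P.complex

/-- `Tor` is derived in its second argument, so a single resolution of A serves all M at once. This
is what makes exactness in the first argument accessible. -/
def torIso (n : ℕ) (M : ModuleCat.{u} R) {A : ModuleCat.{u} R} (P : ProjectiveResolution A) :
    tor n M A ≅ (tensorComplex M P).homology n :=
  P.isoLeftDerivedObj ((MonoidalCategory.tensoringLeft (ModuleCat.{u} R)).obj M) n

theorem torMap_eq (n : ℕ) {M N : ModuleCat.{u} R} (f : M ⟶ N) {A : ModuleCat.{u} R}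
    (P : ProjectiveResolution A) :
    torMap n f A = (torIso n M P).hom ≫
      HomologicalComplex.homologyMap (tensorComplexMap f P) n ≫ (torIso n N P).inv :=
  ProjectiveResolution.leftDerived_app_eq _ P n

theorem flat_of_projective (P : ModuleCat.{u} R) [Projective P] : Module.Flat R P := by
  have : Module.Projective R P := (IsProjective.iff_projective P).2 inferInstance
  infer_instance

variable {S : ShortComplex (ModuleCat.{u} R)}

/-- The short complex of complexes `S ⊗ P`. -/
def tensorShortComplex (S : ShortComplex (ModuleCat.{u} R)) {A : ModuleCat.{u} R}
    (P : ProjectiveResolution A) : ShortComplex (ChainComplex (ModuleCat.{u} R) ℕ) :=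
  ShortComplex.mk (tensorComplexMap S.f P) (tensorComplexMap S.g P) (by
    ext i : 1
    have h := MonoidalCategory.comp_whiskerRight S.f S.g (P.complex.X i)
    rw [S.zero, MonoidalPreadditive.zero_whiskerRight] at h
    exact h.symm)

/-- The terms of the resolution are projective, hence flat, so tensoring with them keeps each degree
short exact. -/
theorem tensorShortComplex_shortExact (hS : S.ShortExact) {A : ModuleCat.{u} R}
    (P : ProjectiveResolution A) : (tensorShortComplex S P).ShortExact := by
  refine HomologicalComplex.shortExact_of_degreewise_shortExact _ fun i => ?_
  have := flat_of_projective (P.complex.X i)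
  exact hS.map_of_exact (MonoidalCategory.tensorRight (P.complex.X i))

theorem torMap_comp_eq_zero (n : ℕ) (A : ModuleCat.{u} R) :
    torMap n S.f A ≫ torMap n S.g A = 0 := by
  have h := HomologicalComplex.homologyMap_comp
    (tensorComplexMap S.f (projectiveResolution A)) (tensorComplexMap S.g (projectiveResolution A)) n
  rw [show tensorComplexMap S.f (projectiveResolution A) ≫
      tensorComplexMap S.g (projectiveResolution A) = 0 from
    (tensorShortComplex S (projectiveResolution A)).zero,
    HomologicalComplex.homologyMap_zero] at h
  rw [torMap_eq n S.f (projectiveResolution A), torMap_eq n S.g (projectiveResolution A)]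
  simp [← reassoc_of% h]

theorem torMap_exact (hS : S.ShortExact) (n : ℕ) (A : ModuleCat.{u} R) :
    Function.Exact (torMap n S.f A).hom (torMap n S.g A).hom := by
  let P := projectiveResolution A
  have h := (tensorShortComplex_shortExact hS P).homology_exact₂ n
  rw [← ShortComplex.ShortExact.moduleCat_exact_iff_function_exact
    (ShortComplex.mk (torMap n S.f A) (torMap n S.g A) (torMap_comp_eq_zero n A))]
  exact ShortComplex.exact_of_iso (ShortComplex.isoMk (torIso n S.X₁ P).symm
    (torIso n S.X₂ P).symm (torIso n S.X₃ P).symm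
    (by simp [torMap_eq n S.f P, tensorShortComplex])
    (by simp [torMap_eq n S.g P, tensorShortComplex])) h

theorem exists_connecting_homology (hS : S.ShortExact) (n : ℕ) {A : ModuleCat.{u} R}
    (P : ProjectiveResolution A) :
    ∃ (δ : (tensorComplex S.X₃ P).homology (n + 1) ⟶ (tensorComplex S.X₁ P).homology n)
      (w₃ : HomologicalComplex.homologyMap (tensorComplexMap S.g P) (n + 1) ≫ δ = 0)
      (w₁ : δ ≫ HomologicalComplex.homologyMap (tensorComplexMap S.f P) n = 0),
      (ShortComplex.mk _ _ w₃).Exact ∧ (ShortComplex.mk _ _ w₁).Exact :=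
  have hE := tensorShortComplex_shortExact hS P
  ⟨hE.δ (n + 1) n rfl, hE.comp_δ (n + 1) n rfl, hE.δ_comp (n + 1) n rfl,
    hE.homology_exact₃ (n + 1) n rfl, hE.homology_exact₁ (n + 1) n rfl⟩

theorem exists_connecting (hS : S.ShortExact) (n : ℕ) (A : ModuleCat.{u} R) :
    ∃ δ : tor (n + 1) S.X₃ A →ₗ[R] tor n S.X₁ A,
      Function.Exact (torMap (n + 1) S.g A).hom δ ∧ Function.Exact δ (torMap n S.f A).hom := by
  let P := projectiveResolution A
  obtain ⟨d, w₃, w₁, h₃, h₁⟩ := exists_connecting_homology hS n P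
  refine ⟨((torIso (n + 1) S.X₃ P).hom ≫ d ≫ (torIso n S.X₁ P).inv).hom, ?_, ?_⟩
  · rw [← ShortComplex.ShortExact.moduleCat_exact_iff_function_exact
      (ShortComplex.mk (torMap (n + 1) S.g A) ((torIso (n + 1) S.X₃ P).hom ≫
        d ≫ (torIso n S.X₁ P).inv) (by
          rw [torMap_eq (n + 1) S.g P]; simp [reassoc_of% w₃]))]
    exact ShortComplex.exact_of_iso (ShortComplex.isoMk (torIso (n + 1) S.X₂ P).symm
      (torIso (n + 1) S.X₃ P).symm (torIso n S.X₁ P).symm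
      (by simp [torMap_eq (n + 1) S.g P])
      (by simp)) h₃
  · rw [← ShortComplex.ShortExact.moduleCat_exact_iff_function_exact
      (ShortComplex.mk ((torIso (n + 1) S.X₃ P).hom ≫
        d ≫ (torIso n S.X₁ P).inv) (torMap n S.f A) (by
          rw [torMap_eq n S.f P]; simp [reassoc_of% w₁]))]
    exact ShortComplex.exact_of_iso (ShortComplex.isoMk (torIso (n + 1) S.X₃ P).symm
      (torIso n S.X₁ P).symm (torIso n S.X₂ P).symm
      (by simp)
      (by simp [torMap_eq n S.f P])) h₁

theorem homologyMap_smul_id (K : ChainComplex (ModuleCat.{u} R) ℕ) (n : ℕ) (s : R) :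
    HomologicalComplex.homologyMap (s • 𝟙 K) n = s • 𝟙 (K.homology n) := by
  rw [← HomologicalComplex.homologyMap_id]
  exact ShortComplex.homologyMap_smul
    ((HomologicalComplex.shortComplexFunctor _ _ n).map (𝟙 K)) s

theorem torMap_smul_id (n : ℕ) (M A : ModuleCat.{u} R) (s : R) :
    torMap n (s • 𝟙 M) A = s • 𝟙 _ := by
  have h : tensorComplexMap (s • 𝟙 M) (projectiveResolution A) = s • 𝟙 _ := by
    ext i : 1
    have h := MonoidalLinear.smul_whiskerRight s (𝟙 M) ((projectiveResolution A).complex.X i)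
    rw [MonoidalCategory.id_whiskerRight] at h
    exact h
  rw [torMap_eq n _ (projectiveResolution A), h, homologyMap_smul_id]
  simp

section LeftDerived

variable {G H : ModuleCat.{u} R ⥤ ModuleCat.{u} R} [G.Additive] [H.Additive]

def leftDerivedIso (G : ModuleCat.{u} R ⥤ ModuleCat.{u} R) [G.Additive] (n : ℕ)
    {A : ModuleCat.{u} R} (P : ProjectiveResolution A) :
    (G.leftDerived n).obj A ≅ ((G.mapHomologicalComplex _).obj P.complex).homology n :=
  P.isoLeftDerivedObj G n

theorem leftDerived_map_eq_homologyMap (n : ℕ) {A B : ModuleCat.{u} R} (f : A ⟶ B)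
    (P : ProjectiveResolution A) (Q : ProjectiveResolution B) (φ : P.complex ⟶ Q.complex)
    (h : φ.f 0 ≫ Q.π.f 0 = P.π.f 0 ≫ f) :
    (G.leftDerived n).map f = (leftDerivedIso G n P).hom ≫
      HomologicalComplex.homologyMap ((G.mapHomologicalComplex _).map φ) n ≫
        (leftDerivedIso G n Q).inv := by
  rw [← Category.assoc, Iso.eq_comp_inv]
  exact P.isoLeftDerivedObj_hom_naturality f Q φ h G n

theorem leftDerived_map_smul_id [G.Linear R] (n : ℕ) (A : ModuleCat.{u} R) (s : R) :
    (G.leftDerived n).map (s • 𝟙 A) = s • 𝟙 _ := by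
  let P := projectiveResolution A
  have h : (G.mapHomologicalComplex (ComplexShape.down ℕ)).map (s • 𝟙 P.complex) = s • 𝟙 _ := by
    ext i : 1
    have h := G.map_smul s (𝟙 (P.complex.X i))
    rw [G.map_id] at h
    exact h
  have hs (φ : P.complex.X 0 ⟶ A) : (s • 𝟙 _) ≫ φ = φ ≫ (s • 𝟙 A) := by simp
  rw [leftDerived_map_eq_homologyMap n (s • 𝟙 A) P P (s • 𝟙 _) (hs (P.π.f 0)), h,
    homologyMap_smul_id]
  simp

theorem leftDerived_app_eq_homologyMap (n : ℕ) (α : G ⟶ H) {A : ModuleCat.{u} R}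
    (P : ProjectiveResolution A) :
    (NatTrans.leftDerived α n).app A = (leftDerivedIso G n P).hom ≫
      HomologicalComplex.homologyMap ((NatTrans.mapHomologicalComplex α _).app P.complex) n ≫
        (leftDerivedIso H n P).inv :=
  P.leftDerived_app_eq α n

theorem fromLeftDerivedZero_app_eq (G : ModuleCat.{u} R ⥤ ModuleCat.{u} R) [G.Additive]
    {A : ModuleCat.{u} R} (P : ProjectiveResolution A) :
    G.fromLeftDerivedZero.app A = (leftDerivedIso G 0 P).hom ≫
      HomologicalComplex.homologyι _ 0 ≫ P.fromLeftDerivedZero' G :=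
  P.fromLeftDerivedZero_eq G

/-- Naturality in the functor rather than in the object: it makes the identification of Tor_0 with
the tensor product natural in the first argument. -/
theorem leftDerived_app_comp_fromLeftDerivedZero (α : G ⟶ H) (A : ModuleCat.{u} R) :
    (NatTrans.leftDerived α 0).app A ≫ H.fromLeftDerivedZero.app A =
      G.fromLeftDerivedZero.app A ≫ α.app A := by
  let P := projectiveResolution A
  have h : HomologicalComplex.opcyclesMap ((NatTrans.mapHomologicalComplex α
      (ComplexShape.down ℕ)).app P.complex) 0 ≫ P.fromLeftDerivedZero' H =
      P.fromLeftDerivedZero' G ≫ α.app A := by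
    rw [← cancel_epi (HomologicalComplex.pOpcycles _ _),
      HomologicalComplex.p_opcyclesMap_assoc, ProjectiveResolution.pOpcycles_comp_fromLeftDerivedZero',
      ProjectiveResolution.pOpcycles_comp_fromLeftDerivedZero'_assoc]
    exact (α.naturality _).symm
  rw [leftDerived_app_eq_homologyMap 0 α P, fromLeftDerivedZero_app_eq G P,
    fromLeftDerivedZero_app_eq H P, Category.assoc, Category.assoc, Category.assoc,
    Category.assoc, Iso.inv_hom_id_assoc, HomologicalComplex.homologyι_naturality_assoc, h]

end LeftDerived

theorem tor_map_smul_id (n : ℕ) (M A : ModuleCat.{u} R) (s : R) :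
    ((Tor (ModuleCat.{u} R) n).obj M).map (s • 𝟙 A) = s • 𝟙 _ :=
  leftDerived_map_smul_id (G := (MonoidalCategory.tensoringLeft (ModuleCat.{u} R)).obj M) n A s

/-- Tor is R-linear in each argument: if s • 𝟙 and 0 • 𝟙 agree on M, they agree on Tor. -/
theorem smul_tor_eq_zero_of_left {n : ℕ} {M A : ModuleCat.{u} R} {s : R}
    (h : ∀ x : M, s • x = 0) (t : tor n M A) : s • t = 0 := by
  have h0 : s • 𝟙 M = 0 := by ext x; exact h x
  have := torMap_smul_id n M A s
  rw [h0, ← zero_smul R (𝟙 M), torMap_smul_id, zero_smul] at this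
  exact (congrArg (fun f : tor n M A ⟶ tor n M A => f.hom t) this).symm

theorem smul_tor_eq_zero_of_right {n : ℕ} {M A : ModuleCat.{u} R} {s : R}
    (h : ∀ x : A, s • x = 0) (t : tor n M A) : s • t = 0 := by
  have h0 : s • 𝟙 A = 0 := by ext x; exact h x
  have := tor_map_smul_id n M A s
  rw [h0, ← zero_smul R (𝟙 A), tor_map_smul_id, zero_smul] at this
  exact (congrArg (fun f : tor n M A ⟶ tor n M A => f.hom t) this).symm

/-- M is flat, so tensoring with it keeps the resolution of A exact in positive degrees. -/
theorem subsingleton_tor_succ_of_projective (n : ℕ) (M A : ModuleCat.{u} R) [Projective M] :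
    Subsingleton (tor (n + 1) M A) := by
  let P := projectiveResolution A
  have := flat_of_projective M
  have h : (tensorComplex M P).ExactAt (n + 1) :=
    (P.complex_exactAt_succ n).map (MonoidalCategory.tensorLeft M)
  rw [HomologicalComplex.exactAt_iff_isZero_homology] at h
  exact ModuleCat.subsingleton_of_isZero (h.of_iso (torIso (n + 1) M P))

theorem subsingleton_tor_of_subsingleton (n : ℕ) (M A : ModuleCat.{u} R) [Subsingleton M] :
    Subsingleton (tor n M A) := by
  refine subsingleton_of_forall_eq 0 fun t => ?_
  rw [← one_smul R t]
  exact smul_tor_eq_zero_of_left (fun x => Subsingleton.elim _ _) t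

def torZeroIso (M A : ModuleCat.{u} R) : tor 0 M A ≅ MonoidalCategoryStruct.tensorObj M A :=
  (Functor.leftDerivedZeroIsoSelf ((MonoidalCategory.tensoringLeft _).obj M)).app A

theorem torZeroIso_naturality {M N : ModuleCat.{u} R} (f : M ⟶ N) (A : ModuleCat.{u} R) :
    torMap 0 f A ≫ (torZeroIso N A).hom =
      (torZeroIso M A).hom ≫ MonoidalCategoryStruct.whiskerRight f A :=
  leftDerived_app_comp_fromLeftDerivedZero ((MonoidalCategory.tensoringLeft _).map f) A

/-- `Tor_0` is the tensor product. -/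
def torZeroEquiv (M A : ModuleCat.{u} R) : tor 0 M A ≃ₗ[R] TensorProduct R M A :=
  (torZeroIso M A).toLinearEquiv

theorem torZeroEquiv_torMap {M N : ModuleCat.{u} R} (f : M ⟶ N) (A : ModuleCat.{u} R)
    (t : tor 0 M A) :
    torZeroEquiv N A ((torMap 0 f A).hom t) = f.hom.rTensor A (torZeroEquiv M A t) :=
  congrArg (fun φ => φ.hom t) (torZeroIso_naturality f A)

theorem torMap_zero_surjective {M N : ModuleCat.{u} R} {f : M ⟶ N}
    (hf : Function.Surjective f.hom) (A : ModuleCat.{u} R) :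
    Function.Surjective (torMap 0 f A).hom := by
  intro t
  obtain ⟨y, hy⟩ := LinearMap.rTensor_surjective A hf (torZeroEquiv N A t)
  refine ⟨(torZeroEquiv M A).symm y, (torZeroEquiv N A).injective ?_⟩
  rw [torZeroEquiv_torMap, LinearEquiv.apply_symm_apply, hy]

/-- Dimension shifting: the kernel of a projective cover has projective dimension one less, and the
connecting map embeds Tor_{n+2} of M into Tor_{n+1} of the kernel. -/
theorem subsingleton_tor_of_hasProjectiveDimensionLT (A : ModuleCat.{u} R) :
    ∀ (n : ℕ) (M : ModuleCat.{u} R), HasProjectiveDimensionLT M n → Subsingleton (tor n M A)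
  | 0, M, h => by
    have : Subsingleton M := ModuleCat.subsingleton_of_isZero
      ((hasProjectiveDimensionLT_zero_iff_isZero M).1 h)
    exact subsingleton_tor_of_subsingleton 0 M A
  | 1, M, h => by
    have : Projective M := (projective_iff_hasProjectiveDimensionLT_one).2 h
    exact subsingleton_tor_succ_of_projective 0 M A
  | n + 2, M, h => by
    let S := ShortComplex.mk (Limits.kernel.ι (Projective.π M)) (Projective.π M)
      (Limits.kernel.condition _)
    have hS : S.ShortExact :=
      { exact := ShortComplex.exact_of_f_is_kernel _ (Limits.kernelIsKernel _)
        mono_f := inferInstanceAs (Mono (Limits.kernel.ι _))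
        epi_g := inferInstanceAs (Epi (Projective.π M)) }
    have hP : Projective S.X₂ := inferInstanceAs (Projective (Projective.over M))
    have := subsingleton_tor_of_hasProjectiveDimensionLT A (n + 1) S.X₁
      ((hS.hasProjectiveDimensionLT_X₃_iff n hP).1 h)
    have := subsingleton_tor_succ_of_projective (n + 1) S.X₂ A
    obtain ⟨δ, hδ, -⟩ := exists_connecting hS (n + 1) A
    refine subsingleton_of_forall_eq 0 fun t => ?_
    obtain ⟨y, rfl⟩ := (hδ t).1 (Subsingleton.elim _ _)
    rw [Subsingleton.elim y 0, map_zero]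

end ModuleTor

/-! ### Graded modules over the polynomial ring and minimal free covers -/

namespace MvPolynomial

variable {σ : Type*} {F : Type*} [Field F]

theorem homogeneousComponent_zero_mul_X (p : MvPolynomial σ F) (j : σ) :
    homogeneousComponent 0 (p * X j) = 0 := by
  classical
  rw [homogeneousComponent_zero, coeff_mul_X']
  simp

theorem homogeneousComponent_succ_mul_X (k : ℕ) (p : MvPolynomial σ F) (j : σ) :
    homogeneousComponent (k + 1) (p * X j) = homogeneousComponent k p * X j := by
  classical
  ext d
  rw [coeff_homogeneousComponent, coeff_mul_X', coeff_mul_X', coeff_homogeneousComponent]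
  by_cases h : j ∈ d.support
  · obtain ⟨e, rfl⟩ : ∃ e, d = e + Finsupp.single j 1 :=
      ⟨d - Finsupp.single j 1, (tsub_add_cancel_of_le (by
        simpa [Nat.one_le_iff_ne_zero] using h)).symm⟩
    simp [Finsupp.degree_single]
  · simp [h]

theorem mem_idealOfVars_iff {p : MvPolynomial σ F} :
    p ∈ idealOfVars σ F ↔ constantCoeff p = 0 := by
  rw [idealOfVars, ← Set.image_univ, mem_ideal_span_X_image, constantCoeff_eq]
  constructor
  · intro h
    by_contra hp
    obtain ⟨i, -, hi⟩ := h 0 (mem_support_iff.2 hp)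
    exact hi rfl
  · intro h d hd
    by_contra! hd'
    have : d = 0 := Finsupp.ext fun i => hd' i trivial
    exact mem_support_iff.1 hd (this ▸ h)

/-- An `ℕ`-grading on a module over the polynomial ring, given by the projections to the
homogeneous parts. The coefficients have degree zero and the variables have degree one. -/
structure GradedStructure (σ F M : Type*) [Field F] [AddCommGroup M]
    [Module (MvPolynomial σ F) M] where
  proj : ℕ → M →+ M
  proj_proj : ∀ k l x, proj k (proj l x) = if k = l then proj l x else 0
  eventually_sum : ∀ x, ∀ᶠ n in Filter.atTop, ∑ k ∈ Finset.range n, proj k x = x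
  proj_C_smul : ∀ k a x, proj k ((C a : MvPolynomial σ F) • x) = (C a : MvPolynomial σ F) • proj k x
  proj_zero_X_smul : ∀ j x, proj 0 ((X j : MvPolynomial σ F) • x) = 0
  proj_succ_X_smul : ∀ k j x,
    proj (k + 1) ((X j : MvPolynomial σ F) • x) = (X j : MvPolynomial σ F) • proj k x

namespace GradedStructure

variable {M : Type*} [AddCommGroup M] [Module (MvPolynomial σ F) M]

variable (σ F) in
/-- The standard grading of the polynomial ring. -/
def self : GradedStructure σ F (MvPolynomial σ F) where
  proj k := (homogeneousComponent k).toAddMonoidHom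
  proj_proj k l x := homogeneousComponent_of_mem (homogeneousComponent_mem l x)
  eventually_sum x := by
    filter_upwards [Filter.eventually_ge_atTop (x.totalDegree + 1)] with n hn
    conv_rhs => rw [← sum_homogeneousComponent x]
    refine (Finset.sum_subset (Finset.range_mono hn) fun k _ hk => ?_).symm
    exact homogeneousComponent_eq_zero _ _ (by simpa using hk)
  proj_C_smul k a x := by simp
  proj_zero_X_smul j x := by
    simpa [mul_comm] using homogeneousComponent_zero_mul_X x j
  proj_succ_X_smul k j x := by
    simpa [mul_comm] using homogeneousComponent_succ_mul_X k x j

/-- The grading shifted upwards by `d`. -/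
def shift (𝒢 : GradedStructure σ F M) (d : ℕ) : GradedStructure σ F M where
  proj k := if d ≤ k then 𝒢.proj (k - d) else 0
  proj_proj k l x := by
    by_cases hk : d ≤ k <;> by_cases hl : d ≤ l
    · simp only [hk, hl, if_true, 𝒢.proj_proj]
      congr 1
      simp only [eq_iff_iff]
      omega
    · simp [hk, hl]
    · have : k ≠ l := by omega
      simp [hk, hl, this]
    · simp [hk, hl]
  eventually_sum x := by
    obtain ⟨n, hn⟩ := Filter.eventually_atTop.1 (𝒢.eventually_sum x)
    filter_upwards [Filter.eventually_ge_atTop (d + n)] with N hN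
    obtain ⟨r, rfl⟩ := Nat.exists_eq_add_of_le ((Nat.le_add_right d n).trans hN)
    rw [Finset.sum_range_add, Finset.sum_eq_zero, zero_add]
    · simpa using hn r (by omega)
    · intro k hk
      rw [if_neg (by simpa using hk)]
      rfl
  proj_C_smul k a x := by
    split_ifs
    · exact 𝒢.proj_C_smul _ a x
    · simp
  proj_zero_X_smul j x := by
    split_ifs
    · simpa using 𝒢.proj_zero_X_smul j x
    · simp
  proj_succ_X_smul k j x := by
    by_cases hk : d ≤ k
    · rw [if_pos hk, if_pos (by omega), Nat.succ_sub hk]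
      exact 𝒢.proj_succ_X_smul _ j x
    · rw [if_neg hk]
      split_ifs with h
      · rw [show k + 1 - d = 0 by omega, 𝒢.proj_zero_X_smul]
        simp
      · simp

/-- The componentwise grading of a finite product. -/
def pi {ι : Type*} [Finite ι] {M : ι → Type*} [∀ i, AddCommGroup (M i)]
    [∀ i, Module (MvPolynomial σ F) (M i)] (𝒢 : ∀ i, GradedStructure σ F (M i)) :
    GradedStructure σ F (∀ i, M i) where
  proj k := AddMonoidHom.mk' (fun g i => (𝒢 i).proj k (g i)) (by intro a b; ext i; simp)
  proj_proj k l x := by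
    ext i
    simp only [AddMonoidHom.mk'_apply, (𝒢 i).proj_proj]
    split_ifs <;> rfl
  eventually_sum x := by
    filter_upwards [Filter.eventually_all.2 fun i => (𝒢 i).eventually_sum (x i)] with n hn
    ext i
    simpa using hn i
  proj_C_smul k a x := by ext i; exact (𝒢 i).proj_C_smul k a (x i)
  proj_zero_X_smul j x := by ext i; exact (𝒢 i).proj_zero_X_smul j (x i)
  proj_succ_X_smul k j x := by ext i; exact (𝒢 i).proj_succ_X_smul k j (x i)

/-- The induced grading of a graded submodule. -/
def submodule (𝒢 : GradedStructure σ F M) (N : Submodule (MvPolynomial σ F) M)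
    (hN : ∀ k, ∀ x ∈ N, 𝒢.proj k x ∈ N) : GradedStructure σ F N where
  proj k := AddMonoidHom.mk' (fun x => ⟨𝒢.proj k x, hN k x x.2⟩) (by intro a b; ext; simp)
  proj_proj k l x := by
    ext
    simp only [AddMonoidHom.mk'_apply, 𝒢.proj_proj]
    split_ifs <;> rfl
  eventually_sum x := by
    filter_upwards [𝒢.eventually_sum x] with n hn
    ext
    simpa using hn
  proj_C_smul k a x := by ext; exact 𝒢.proj_C_smul k a x
  proj_zero_X_smul j x := by ext; exact 𝒢.proj_zero_X_smul j x
  proj_succ_X_smul k j x := by ext; exact 𝒢.proj_succ_X_smul k j x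

/-- The induced grading of the quotient by a graded submodule. -/
def quotient (𝒢 : GradedStructure σ F M) (N : Submodule (MvPolynomial σ F) M)
    (hN : ∀ k, ∀ x ∈ N, 𝒢.proj k x ∈ N) : GradedStructure σ F (M ⧸ N) where
  proj k := QuotientAddGroup.map N.toAddSubgroup N.toAddSubgroup (𝒢.proj k) (hN k)
  proj_proj k l x := by
    obtain ⟨x, rfl⟩ := N.mkQ_surjective x
    have := congrArg N.mkQ (𝒢.proj_proj k l x)
    rw [apply_ite N.mkQ, map_zero] at this
    exact this
  eventually_sum x := by
    obtain ⟨x, rfl⟩ := N.mkQ_surjective x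
    filter_upwards [𝒢.eventually_sum x] with n hn
    conv_rhs => rw [← hn, map_sum]
    rfl
  proj_C_smul k a x := by
    obtain ⟨x, rfl⟩ := N.mkQ_surjective x
    exact congrArg N.mkQ (𝒢.proj_C_smul k a x)
  proj_zero_X_smul j x := by
    obtain ⟨x, rfl⟩ := N.mkQ_surjective x
    exact congrArg N.mkQ (𝒢.proj_zero_X_smul j x)
  proj_succ_X_smul k j x := by
    obtain ⟨x, rfl⟩ := N.mkQ_surjective x
    exact congrArg N.mkQ (𝒢.proj_succ_X_smul k j x)

variable (𝒢 : GradedStructure σ F M)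

/-- A homogeneous element of degree d defines a graded map from the polynomial ring shifted by d;
this makes the free cover by homogeneous generators a graded map. -/
theorem proj_smul_of_proj_eq {d : ℕ} {x : M} (hx : 𝒢.proj d x = x) (p : MvPolynomial σ F) (k : ℕ) :
    𝒢.proj k (p • x) = ((self σ F).shift d).proj k p • x := by
  induction p using MvPolynomial.induction_on generalizing k with
  | C a =>
    rw [𝒢.proj_C_smul]
    have h := 𝒢.proj_proj k d x
    rw [hx] at h
    have hC : ((self σ F).shift d).proj k (C a) = if k = d then C a else 0 := by
      by_cases hk : d ≤ k
      · have : homogeneousComponent (k - d) (C a : MvPolynomial σ F) =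
            if k - d = 0 then C a else 0 :=
          homogeneousComponent_of_mem (isHomogeneous_C σ a)
        simp only [shift, self, hk, if_true]
        refine this.trans ?_
        congr 1
        simp only [eq_iff_iff]
        omega
      · have : k ≠ d := by omega
        simp [shift, hk, this]
    rw [h, hC]
    split_ifs <;> simp
  | add p q hp hq => rw [add_smul, map_add, hp, hq, map_add, add_smul]
  | mul_X p j hp =>
    rw [mul_comm p, mul_smul]
    cases k with
    | zero =>
      rw [𝒢.proj_zero_X_smul, ← smul_eq_mul, proj_zero_X_smul, zero_smul]
    | succ k =>
      rw [𝒢.proj_succ_X_smul, ← smul_eq_mul, proj_succ_X_smul, hp, smul_eq_mul, mul_smul]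

theorem proj_proj_self (k : ℕ) (x : M) : 𝒢.proj k (𝒢.proj k x) = 𝒢.proj k x := by
  rw [𝒢.proj_proj, if_pos rfl]

theorem span_homogeneous :
    Submodule.span (MvPolynomial σ F) {x | ∃ d, 𝒢.proj d x = x} = ⊤ := by
  rw [eq_top_iff]
  intro x _
  obtain ⟨n, hn⟩ := (𝒢.eventually_sum x).exists
  rw [← hn]
  exact Submodule.sum_mem _ fun k _ => Submodule.subset_span ⟨k, 𝒢.proj_proj_self k x⟩

/-- Homogeneous elements span, so finitely many of them do; an inclusion-minimal such set has no
redundant element. -/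
theorem exists_minimal_generators [Module.Finite (MvPolynomial σ F) M] :
    ∃ s : Finset M, (∀ x ∈ s, ∃ d, 𝒢.proj d x = x) ∧
      Submodule.span (MvPolynomial σ F) (s : Set M) = ⊤ ∧
      ∀ x ∈ s, x ∉ Submodule.span (MvPolynomial σ F) ((s : Set M) \ {x}) := by
  classical
  obtain ⟨t, ht, hts⟩ := Submodule.fg_span_iff_fg_span_finset_subset _ |>.1
    (𝒢.span_homogeneous ▸ (Module.Finite.fg_top : (⊤ : Submodule (MvPolynomial σ F) M).FG))
  rw [𝒢.span_homogeneous] at hts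
  obtain ⟨s, ⟨hs₁, hs₂⟩, hs₃⟩ := exists_minimal_of_wellFoundedLT
    (fun s : Finset M => (∀ x ∈ s, ∃ d, 𝒢.proj d x = x) ∧
      Submodule.span (MvPolynomial σ F) (s : Set M) = ⊤) ⟨t, fun x hx => ht hx, hts.symm⟩
  refine ⟨s, hs₁, hs₂, fun x hx hx' => ?_⟩
  have := hs₃ (y := s.erase x) ⟨fun y hy => hs₁ y (Finset.mem_of_mem_erase hy), ?_⟩
    (Finset.erase_subset _ _) hx
  · exact Finset.notMem_erase x s this
  · rw [eq_top_iff, ← hs₂, Submodule.span_le]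
    intro y hy
    rw [Finset.coe_erase]
    by_cases hyx : y = x
    · exact hyx ▸ hx'
    · exact Submodule.subset_span ⟨hy, hyx⟩

theorem mem_idealOfVars_smul_top {ι : Type*} [Fintype ι] {g : ι → MvPolynomial σ F}
    (hg : ∀ i, g i ∈ idealOfVars σ F) :
    g ∈ idealOfVars σ F • (⊤ : Submodule (MvPolynomial σ F) (ι → MvPolynomial σ F)) := by
  classical
  rw [pi_eq_sum_univ g]
  exact Submodule.sum_mem _ fun i _ => Submodule.smul_mem_smul (hg i) trivial

/-- A finitely generated graded module has a graded free cover whose kernel lies in the maximal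
homogeneous ideal times the cover. -/
theorem exists_minimal_cover (𝒢 : GradedStructure σ F M) [Module.Finite (MvPolynomial σ F) M] :
    ∃ (n : ℕ) (f : (Fin n → MvPolynomial σ F) →ₗ[MvPolynomial σ F] M),
      Function.Surjective f ∧ LinearMap.ker f ≤ idealOfVars σ F • ⊤ ∧
      Nonempty (GradedStructure σ F (LinearMap.ker f)) := by
  classical
  obtain ⟨s, hd, hs, hmin⟩ := 𝒢.exists_minimal_generators
  let e := s.equivFin
  let v : Fin s.card → M := fun i => (e.symm i : M)
  choose d hd using fun i : Fin s.card => hd (v i) (e.symm i).2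
  let f := Fintype.linearCombination (MvPolynomial σ F) v
  let 𝒮 := pi fun i => (self σ F).shift (d i)
  have hv : Set.range v = s := by
    ext x
    constructor
    · rintro ⟨i, rfl⟩
      exact (e.symm i).2
    · intro hx
      exact ⟨e ⟨x, hx⟩, by simp [v]⟩
  have hf (g) : f g = ∑ i, g i • v i := Fintype.linearCombination_apply _ _ _
  have hproj (k g) : 𝒢.proj k (f g) = f (𝒮.proj k g) := by
    rw [hf, hf, map_sum]
    exact Finset.sum_congr rfl fun i _ => 𝒢.proj_smul_of_proj_eq (hd i) (g i) k
  have hker (k g) (hg : g ∈ LinearMap.ker f) : 𝒮.proj k g ∈ LinearMap.ker f := by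
    rw [LinearMap.mem_ker] at hg ⊢
    rw [← hproj, hg, map_zero]
  refine ⟨s.card, f, ?_, ?_, ⟨𝒮.submodule _ hker⟩⟩
  · rw [← LinearMap.range_eq_top, Fintype.range_linearCombination, hv, hs]
  · intro g hg
    refine mem_idealOfVars_smul_top fun i => ?_
    by_contra hi
    rw [mem_idealOfVars_iff, constantCoeff_eq] at hi
    -- The kernel is graded, so the degree-`d i` part of the relation `g` is again a relation. Its
    -- i-th coefficient is the nonzero constant term of `g i`, a unit, so `v i` would be redundant.
    have h0 := hker (d i) g hg
    rw [LinearMap.mem_ker, hf, ← Finset.add_sum_erase _ _ (Finset.mem_univ i)] at h0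
    have hi' : 𝒮.proj (d i) g i = C (coeff 0 (g i)) := by
      simp [𝒮, pi, shift, self]
    rw [hi'] at h0
    refine hmin (v i) (e.symm i).2 ?_
    have h1 : (C (coeff 0 (g i)) : MvPolynomial σ F) • v i ∈
        Submodule.span (MvPolynomial σ F) ((s : Set M) \ {v i}) := by
      rw [eq_neg_of_add_eq_zero_left h0]
      refine Submodule.neg_mem _ (Submodule.sum_mem _ fun j hj => Submodule.smul_mem _ _
        (Submodule.subset_span ⟨(e.symm j).2, fun h => ?_⟩))
      exact Finset.ne_of_mem_erase hj (e.symm.injective (Subtype.ext h))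
    have h2 := Submodule.smul_mem _ (C (coeff 0 (g i))⁻¹ : MvPolynomial σ F) h1
    rwa [smul_smul, ← C_mul, inv_mul_cancel₀ hi, C_1, one_smul] at h2

end GradedStructure
end MvPolynomial

/-! ### Tor_0 of free modules and of minimal maps -/

namespace ModuleTor

variable {R : Type u} [CommRing R]

/-- The short complex of modules given by two linear maps. -/
abbrev shortComplexOfLinear {M₁ M₂ M₃ : Type u} [AddCommGroup M₁] [AddCommGroup M₂]
    [AddCommGroup M₃] [Module R M₁] [Module R M₂] [Module R M₃] (f : M₁ →ₗ[R] M₂) (g : M₂ →ₗ[R] M₃)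
    (h : Function.Exact f g) : ShortComplex (ModuleCat.{u} R) :=
  ShortComplex.mk (ModuleCat.ofHom f) (ModuleCat.ofHom g) (by
    ext x
    exact h.apply_apply_eq_zero x)

theorem shortComplexOfLinear_shortExact {M₁ M₂ M₃ : Type u} [AddCommGroup M₁] [AddCommGroup M₂]
    [AddCommGroup M₃] [Module R M₁] [Module R M₂] [Module R M₃] {f : M₁ →ₗ[R] M₂} {g : M₂ →ₗ[R] M₃}
    (h : Function.Exact f g) (hf : Function.Injective f) (hg : Function.Surjective g) :
    (shortComplexOfLinear f g h).ShortExact where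
  exact := (ShortComplex.ShortExact.moduleCat_exact_iff_function_exact _).2 h
  mono_f := (ModuleCat.mono_iff_injective _).2 hf
  epi_g := (ModuleCat.epi_iff_surjective _).2 hg

theorem length_tor_zero_pi {ι : Type} [Fintype ι] (A : ModuleCat.{u} R) :
    Module.length R (tor 0 (ModuleCat.of R (ι → R)) A) =
      Fintype.card ι * Module.length R A := by
  classical
  rw [((torZeroEquiv (ModuleCat.of R (ι → R)) A).trans
    ((TensorProduct.comm R _ _).trans (TensorProduct.piScalarRight R R A ι))).length_eq]
  simp

/-- For r in I, (r n) ⊗ a = n ⊗ (r a) = 0. This is how minimality of a cover enters. -/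
theorem torMap_zero_eq_zero {M N : ModuleCat.{u} R} (f : M ⟶ N) (A : ModuleCat.{u} R) {I : Ideal R}
    (hf : ∀ x, f.hom x ∈ I • (⊤ : Submodule R N)) (hI : ∀ r ∈ I, ∀ a : A, r • a = 0)
    (t : tor 0 M A) : (torMap 0 f A).hom t = 0 := by
  apply (torZeroEquiv N A).injective
  rw [torZeroEquiv_torMap, map_zero]
  generalize torZeroEquiv M A t = y
  induction y with
  | zero => simp
  | add x y hx hy => rw [map_add, hx, hy, add_zero]
  | tmul x a =>
    rw [LinearMap.rTensor_tmul]
    have h := hf x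
    generalize f.hom x = z at h
    refine Submodule.smul_induction_on h (fun r hr n _ => ?_) fun x y hx hy => ?_
    · rw [TensorProduct.smul_tmul, hI r hr, TensorProduct.tmul_zero]
    · rw [TensorProduct.add_tmul, hx, hy, add_zero]

end ModuleTor

/-! ### Semicontinuity of Tor at the origin, and projective dimension from vanishing Tor -/

namespace MvPolynomial.GradedStructure
open ModuleTor

variable {m : ℕ} {F : Type u} [Field F]

local notation "P" => MvPolynomial (Fin m) F

/-- Compare the long exact sequences of a minimal cover for `A` and `A₀`. With `A₀`, the map from
the syzygy to the cover vanishes on Tor_0, so the Tor of M is as large as the sequence allows; with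
`A` there is only an upper bound. The module is quantified inside the induction because it is
replaced by its syzygy. -/
theorem length_tor_le {A A₀ : ModuleCat.{u} P} (hA : Module.length P A ≤ 1)
    (hA₀ : 1 ≤ Module.length P A₀) (hI : ∀ r ∈ idealOfVars (Fin m) F, ∀ a : A₀, r • a = 0) (i : ℕ) :
    ∀ (M : Type u) [AddCommGroup M] [Module P M] [Module.Finite P M]
      (_ : GradedStructure (Fin m) F M),
      Module.length P (tor i (ModuleCat.of P M) A) ≤
        Module.length P (tor i (ModuleCat.of P M) A₀) := by
  induction i with
  | zero =>
    intro M _ _ _ 𝒢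
    obtain ⟨n, f, hf, hker, -⟩ := 𝒢.exists_minimal_cover
    have hE := f.exact_subtype_ker_map
    have hS := shortComplexOfLinear_shortExact hE (Submodule.injective_subtype _) hf
    have hsurj (B : ModuleCat.{u} P) := torMap_zero_surjective (f := ModuleCat.ofHom f) hf B
    have hinj : Function.Injective (torMap 0 (ModuleCat.ofHom f) A₀).hom := by
      rw [injective_iff_map_eq_zero]
      intro x hx
      obtain ⟨y, rfl⟩ := (torMap_exact hS 0 A₀ x).1 hx
      exact torMap_zero_eq_zero _ A₀ (fun x : LinearMap.ker f => hker x.2) hI y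
    calc _ ≤ Module.length P (tor 0 (ModuleCat.of P (Fin n → P)) A) :=
          Module.length_le_of_surjective _ (hsurj A)
      _ ≤ Module.length P (tor 0 (ModuleCat.of P (Fin n → P)) A₀) := by
          rw [length_tor_zero_pi, length_tor_zero_pi]
          gcongr
          exact hA.trans hA₀
      _ ≤ _ := Module.length_le_of_injective _ hinj
  | succ i ih =>
    intro M _ _ _ 𝒢
    obtain ⟨n, f, hf, hker, ⟨𝒢'⟩⟩ := 𝒢.exists_minimal_cover
    have hE := f.exact_subtype_ker_map
    have hS := shortComplexOfLinear_shortExact hE (Submodule.injective_subtype _) hf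
    have hP : Projective (ModuleCat.of P (Fin n → P)) :=
      (IsProjective.iff_projective _).1 inferInstance
    have := subsingleton_tor_succ_of_projective i (ModuleCat.of P (Fin n → P)) A
    obtain ⟨δ, hδ, -⟩ := exists_connecting hS i A
    obtain ⟨δ₀, -, hδ₀⟩ := exists_connecting hS i A₀
    calc _ ≤ Module.length P (tor i (ModuleCat.of P (LinearMap.ker f)) A) := by
          refine Module.length_le_of_injective δ ((injective_iff_map_eq_zero _).2 fun x hx => ?_)
          obtain ⟨y, rfl⟩ := (hδ x).1 hx
          rw [show y = 0 from Subsingleton.elim (α := tor (i + 1) (ModuleCat.of P (Fin n → P)) A) _ _,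
            map_zero]
      _ ≤ Module.length P (tor i (ModuleCat.of P (LinearMap.ker f)) A₀) := ih _ 𝒢'
      _ ≤ _ := by
          -- The next map is zero: by minimality of the cover in degree 0, and because the cover is
          -- free in higher degrees.
          refine Module.length_le_of_surjective δ₀ fun x => (hδ₀ x).1 ?_
          cases i with
          | zero => exact torMap_zero_eq_zero _ A₀ (fun x : LinearMap.ker f => hker x.2) hI x
          | succ i =>
            have := subsingleton_tor_succ_of_projective i (ModuleCat.of P (Fin n → P)) A₀
            exact Subsingleton.elim (α := tor (i + 1) (ModuleCat.of P (Fin n → P)) A₀) _ _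

/-- The base case is a graded Nakayama lemma: for a minimal cover, Tor_0(M, A₀) = 0 forces the cover
to have rank 0. In the induction step the connecting map is onto, so the vanishing passes to the
syzygy. -/
theorem hasProjectiveDimensionLT_of_subsingleton_tor {A₀ : ModuleCat.{u} P}
    (hA₀ : 1 ≤ Module.length P A₀) (hI : ∀ r ∈ idealOfVars (Fin m) F, ∀ a : A₀, r • a = 0) (i : ℕ) :
    ∀ (M : Type u) [AddCommGroup M] [Module P M] [Module.Finite P M]
      (_ : GradedStructure (Fin m) F M) (_ : Subsingleton (tor i (ModuleCat.of P M) A₀)),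
      HasProjectiveDimensionLT (ModuleCat.of P M) i := by
  induction i with
  | zero =>
    intro M _ _ _ 𝒢 h
    obtain ⟨n, f, hf, hker, -⟩ := 𝒢.exists_minimal_cover
    have hE := f.exact_subtype_ker_map
    have hS := shortComplexOfLinear_shortExact hE (Submodule.injective_subtype _) hf
    have h0 : Subsingleton (tor 0 (ModuleCat.of P (Fin n → P)) A₀) := by
      refine subsingleton_of_forall_eq 0 fun x => ?_
      obtain ⟨y, rfl⟩ := (torMap_exact hS 0 A₀ x).1 (Subsingleton.elim (α := tor 0 (ModuleCat.of P M) A₀) _ _)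
      exact torMap_zero_eq_zero _ A₀ (fun x : LinearMap.ker f => hker x.2) hI y
    have h1 := length_tor_zero_pi (R := P) (ι := Fin n) A₀
    rw [Module.length_eq_zero, eq_comm, mul_eq_zero, Fintype.card_fin] at h1
    obtain h1 | h1 := h1
    · obtain rfl : n = 0 := by exact_mod_cast h1
      have : Subsingleton M := hf.subsingleton
      exact (hasProjectiveDimensionLT_zero_iff_isZero _).2 (ModuleCat.isZero_of_subsingleton _)
    · rw [h1] at hA₀
      simp at hA₀
  | succ i ih =>
    intro M _ _ _ 𝒢 h
    obtain ⟨n, f, hf, hker, ⟨𝒢'⟩⟩ := 𝒢.exists_minimal_cover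
    have hE := f.exact_subtype_ker_map
    have hS := shortComplexOfLinear_shortExact hE (Submodule.injective_subtype _) hf
    have hP : Projective (ModuleCat.of P (Fin n → P)) :=
      (IsProjective.iff_projective _).1 inferInstance
    obtain ⟨δ₀, -, hδ₀⟩ := exists_connecting hS i A₀
    have hK : HasProjectiveDimensionLT (ModuleCat.of P (LinearMap.ker f)) i := by
      refine ih _ 𝒢' (subsingleton_of_forall_eq 0 fun x => ?_)
      obtain ⟨y, rfl⟩ := (hδ₀ x).1 (by
        cases i with
        | zero => exact torMap_zero_eq_zero _ A₀ (fun x : LinearMap.ker f => hker x.2) hI x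
        | succ i =>
          have := subsingleton_tor_succ_of_projective i (ModuleCat.of P (Fin n → P)) A₀
          exact Subsingleton.elim (α := tor (i + 1) (ModuleCat.of P (Fin n → P)) A₀) _ _)
      rw [show y = 0 from Subsingleton.elim (α := tor (i + 1) (ModuleCat.of P M) A₀) _ _,
        map_zero]
    refine hS.hasProjectiveDimensionLT_X₃ i hK ?_
    have : HasProjectiveDimensionLT (ModuleCat.of P (Fin n → P)) (1 + i) := inferInstance
    rwa [add_comm] at this

end MvPolynomial.GradedStructure

/-! ### Residue fields at points and the Koszul computation -/

namespace MvPolynomial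

variable {m : ℕ} {F : Type u} [Field F]

local notation "P" => MvPolynomial (Fin m) F

open ModuleTor

/-- The field as a module over the polynomial ring through evaluation at a point. -/
def evalModule (a : Fin m → F) : ModuleCat.{u} (MvPolynomial (Fin m) F) :=
  (ModuleCat.restrictScalars (eval a)).obj (ModuleCat.of F F)

theorem smul_evalModule (a : Fin m → F) (p : P) (x : evalModule a) :
    p • x = (show evalModule a from (eval a p * (show F from x) : F)) := rfl

/-- Lets dimensions over F be measured as lengths over the polynomial ring, where the exact
sequences of Tor live. -/
theorem length_eq_of_smul_eq {R S V : Type*} [CommRing R] [CommRing S] [AddCommGroup V]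
    [Module R V] [Module S V] (φ : R →+* S) (hφ : Function.Surjective φ)
    (h : ∀ (r : R) (v : V), r • v = φ r • v) : Module.length R V = Module.length S V := by
  let := φ.toAlgebra
  have : IsScalarTower R S V := ⟨fun r s v => by rw [h, smul_smul]; rfl⟩
  exact Module.length_eq_of_surjective hφ

theorem length_restrictScalars_field {R : Type u} [CommRing R] (φ : R →+* F)
    (hφ : Function.Surjective φ) :
    Module.length R ((ModuleCat.restrictScalars φ).obj (ModuleCat.of F F)) = 1 := by
  let : Module R F := Module.compHom F φ
  have h : Module.length R F = Module.length F F := length_eq_of_smul_eq φ hφ fun _ _ => rfl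
  rw [Module.length_eq_one F F] at h
  exact h

theorem length_evalModule (a : Fin m → F) : Module.length P (evalModule a) = 1 :=
  length_restrictScalars_field (eval a) fun c => ⟨C c, eval_C c⟩

/-- Multiplying by X_j leaves the exponents at the indices in τ unchanged. Hence X_j is a
nonzerodivisor modulo the other variables. -/
theorem mul_X_mem_span_X_iff {τ : Set (Fin m)} {j : Fin m} (hj : j ∉ τ) {p : P} :
    X j * p ∈ Ideal.span (X '' τ : Set P) ↔ p ∈ Ideal.span (X '' τ : Set P) := by
  classical
  refine ⟨fun h => ?_, fun h => Ideal.mul_mem_left _ _ h⟩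
  rw [mem_ideal_span_X_image] at h ⊢
  intro d hd
  obtain ⟨i, hi, hdi⟩ := h (Finsupp.single j 1 + d) (by
    rw [mem_support_iff, coeff_X_mul]
    exact mem_support_iff.1 hd)
  refine ⟨i, hi, ?_⟩
  have : j ≠ i := fun h => hj (h ▸ hi)
  simpa [Finsupp.single_apply, this] using hdi

/-- The Tor modules of a coordinate subspace with a point on it. -/
theorem length_tor_quotient_span_X {A : ModuleCat.{u} P} (hA : Module.length P A = 1)
    (τ : Finset (Fin m)) (hτ : ∀ j ∈ τ, ∀ a : A, (X j : P) • a = 0) (i : ℕ) :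
    Module.length P (tor i (ModuleCat.of P (P ⧸ Ideal.span (X '' (τ : Set (Fin m)) : Set P))) A) =
      τ.card.choose i := by
  classical
  induction τ using Finset.induction_on generalizing i with
  | empty =>
    let e : (P ⧸ Ideal.span (X '' ((∅ : Finset (Fin m)) : Set (Fin m)) : Set P)) ≃ₗ[P] P :=
      Submodule.quotEquivOfEqBot _ (by simp)
    cases i with
    | zero =>
      rw [((torZeroEquiv _ A).trans
        ((TensorProduct.congr e (LinearEquiv.refl P A)).trans (TensorProduct.lid P A))).length_eq]
      simpa using hA
    | succ i =>
      have : Module.Projective P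
          (P ⧸ Ideal.span (X '' ((∅ : Finset (Fin m)) : Set (Fin m)) : Set P)) :=
        Module.Projective.of_equiv e.symm
      have : Projective (ModuleCat.of P
          (P ⧸ Ideal.span (X '' ((∅ : Finset (Fin m)) : Set (Fin m)) : Set P))) :=
        (IsProjective.iff_projective _).1 this
      have := subsingleton_tor_succ_of_projective i (ModuleCat.of P
          (P ⧸ Ideal.span (X '' ((∅ : Finset (Fin m)) : Set (Fin m)) : Set P))) A
      rw [Module.length_eq_zero]
      simp
  | insert j τ hj ih =>
    replace ih := ih fun k hk => hτ k (Finset.mem_insert_of_mem hk)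
    set I : Ideal P := Ideal.span (X '' (τ : Set (Fin m)) : Set P) with hI
    set J : Ideal P := Ideal.span (X '' ((insert j τ : Finset (Fin m)) : Set (Fin m)) : Set P)
      with hJ
    have hJI : J = Ideal.span {X j} ⊔ I := by
      rw [hJ, hI, Finset.coe_insert, Set.image_insert_eq, Ideal.span_insert]
    have hIJ : I ≤ J := hJI ▸ le_sup_right
    -- One Koszul step: 0 → P/I → P/I → P/J → 0, the first map being multiplication by X_j.
    let f : (P ⧸ I) →ₗ[P] (P ⧸ I) := (X j : P) • LinearMap.id
    let g : (P ⧸ I) →ₗ[P] (P ⧸ J) := Submodule.factor hIJ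
    have hf : Function.Injective f := by
      rw [injective_iff_map_eq_zero]
      intro x hx
      obtain ⟨p, rfl⟩ := Submodule.mkQ_surjective I x
      have hx : Submodule.Quotient.mk (p := I) (X j * p) = 0 := hx
      rw [Submodule.Quotient.mk_eq_zero, mul_X_mem_span_X_iff (by simpa using hj)] at hx
      exact (Submodule.Quotient.mk_eq_zero I).2 hx
    have hg : Function.Surjective g := Submodule.factor_surjective hIJ
    have hfg : Function.Exact f g := by
      intro x
      obtain ⟨p, rfl⟩ := Submodule.mkQ_surjective I x
      have : g (I.mkQ p) = J.mkQ p := rfl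
      rw [this, Submodule.mkQ_apply, Submodule.Quotient.mk_eq_zero, hJI]
      constructor
      · intro hp
        obtain ⟨y, hy, z, hz, rfl⟩ := Submodule.mem_sup.1 hp
        obtain ⟨q, rfl⟩ := Ideal.mem_span_singleton'.1 hy
        refine ⟨I.mkQ q, (Submodule.Quotient.eq I).2 ?_⟩
        have : (X j : P) • q - (q * X j + z) = -z := by rw [smul_eq_mul]; ring
        rw [this]
        exact I.neg_mem hz
      · rintro ⟨y, hy⟩
        obtain ⟨q, rfl⟩ := Submodule.mkQ_surjective I y
        have hy : X j * q - p ∈ I := (Submodule.Quotient.eq I).1 hy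
        rw [show p = q * X j + -(X j * q - p) by ring]
        exact Submodule.add_mem_sup (Ideal.mem_span_singleton'.2 ⟨q, rfl⟩) (I.neg_mem hy)
    have hS := shortComplexOfLinear_shortExact hfg hf hg
    -- On Tor this map is again multiplication by X_j, which is zero since X_j kills `A`. The long
    -- exact sequence therefore splits into short ones, and lengths add by Pascal's rule.
    have h0 (i : ℕ) (t) : (torMap i (ModuleCat.ofHom f) A).hom t = 0 := by
      have h1 : ModuleCat.ofHom f = (X j : P) • 𝟙 (ModuleCat.of P (P ⧸ I)) := rfl
      rw [h1, torMap_smul_id]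
      exact smul_tor_eq_zero_of_right (hτ j (Finset.mem_insert_self j τ)) t
    have hinj (i : ℕ) : Function.Injective (torMap i (ModuleCat.ofHom g) A).hom := by
      rw [injective_iff_map_eq_zero]
      intro x hx
      obtain ⟨y, rfl⟩ := (torMap_exact hS i A x).1 hx
      exact h0 i y
    rw [Finset.card_insert_of_notMem hj]
    cases i with
    | zero =>
      rw [← (LinearEquiv.ofBijective _ ⟨hinj 0, torMap_zero_surjective
        (f := ModuleCat.ofHom g) hg A⟩).length_eq, ih]
      simp
    | succ i =>
      obtain ⟨δ, hδ, hδ'⟩ := exists_connecting hS i A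
      rw [Module.length_eq_add_of_exact (torMap (i + 1) (ModuleCat.ofHom g) A).hom δ (hinj (i + 1))
        (fun x => (hδ' x).1 (h0 i x)) hδ, ih, ih, Nat.choose_succ_succ, add_comm]
      norm_cast

namespace GradedStructure

variable {σ : Type*} {M : Type*} [AddCommGroup M] [Module (MvPolynomial σ F) M]

theorem proj_smul_mem (𝒢 : GradedStructure σ F M) {N : Submodule (MvPolynomial σ F) M} {x : M}
    (hx : ∀ k, 𝒢.proj k x ∈ N) (p : MvPolynomial σ F) (k : ℕ) : 𝒢.proj k (p • x) ∈ N := by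
  induction p using MvPolynomial.induction_on generalizing k with
  | C a =>
    rw [𝒢.proj_C_smul]
    exact N.smul_mem _ (hx k)
  | add p q hp hq =>
    rw [add_smul, map_add]
    exact N.add_mem (hp k) (hq k)
  | mul_X p j hp =>
    rw [mul_comm p, mul_smul]
    cases k with
    | zero => simp [𝒢.proj_zero_X_smul]
    | succ k =>
      rw [𝒢.proj_succ_X_smul]
      exact N.smul_mem _ (hp k)

/-- Used to grade F[K]: its ideal is generated by monomials, so it is stable under the projections.
-/
theorem proj_mem_span (𝒢 : GradedStructure σ F M) {s : Set M}
    (hs : ∀ x ∈ s, ∃ d, 𝒢.proj d x = x) (k : ℕ) (x : M)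
    (hx : x ∈ Submodule.span (MvPolynomial σ F) s) :
    𝒢.proj k x ∈ Submodule.span (MvPolynomial σ F) s := by
  induction hx using Submodule.span_induction generalizing k with
  | mem x hx =>
    obtain ⟨d, hd⟩ := hs x hx
    rw [← hd, 𝒢.proj_proj, hd]
    split_ifs
    · exact Submodule.subset_span hx
    · exact Submodule.zero_mem _
  | zero => simp
  | add x y _ _ hx hy =>
    rw [map_add]
    exact Submodule.add_mem _ (hx k) (hy k)
  | smul p x _ hx => exact 𝒢.proj_smul_mem hx p k

end GradedStructure

end MvPolynomial

/-! ### Lower bound for the Betti numbers of F[K] from a maximal simplex -/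

namespace AbstractSimplicialComplex

open MvPolynomial ModuleTor

variable {m : ℕ} (F : Type u) [Field F] (K : AbstractSimplicialComplex (Fin m))

local notation "P" => MvPolynomial (Fin m) F

/-- The grading of the Stanley-Reisner ring by total degree. -/
def stanleyReisnerGrading : GradedStructure (Fin m) F (K.StanleyReisnerRing F) :=
  (GradedStructure.self (Fin m) F).quotient (K.stanleyReisnerIdeal F) <|
    GradedStructure.proj_mem_span _ (by
      rintro _ ⟨σ, -, rfl⟩
      exact ⟨_, homogeneousComponent_eq_self
        (IsHomogeneous.prod σ _ (fun _ => 1) fun i _ => isHomogeneous_X F i)⟩)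

theorem mem_simplices_of_subset {σ ρ : Finset (Fin m)} (hσ : σ ∈ K.simplices) (h : ρ ⊆ σ) :
    ρ ∈ K.simplices := by
  rcases ρ.eq_empty_or_nonempty with rfl | hρ
  · exact Or.inl rfl
  · rcases hσ with rfl | hσ
    · exact absurd (Finset.subset_empty.1 h) hρ.ne_empty
    · exact Or.inr ((K.isRelLowerSet_faces hσ).2 h hρ)

variable {K}

/-- A non-simplex is not contained in σ, so its monomial involves a variable outside σ. Hence F[K]
maps onto the coordinate ring of the subspace of σ. -/
theorem stanleyReisnerIdeal_le {σ : Finset (Fin m)} (hσ : σ ∈ K.simplices) :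
    K.stanleyReisnerIdeal F ≤ Ideal.span (X '' ((σᶜ : Finset (Fin m)) : Set (Fin m)) : Set P) := by
  refine Ideal.span_le.2 ?_
  rintro _ ⟨ρ, hρ, rfl⟩
  obtain ⟨j, hj, hjσ⟩ := Finset.not_subset.1 fun h => hρ (K.mem_simplices_of_subset hσ h)
  exact Ideal.mem_of_dvd _ (Finset.dvd_prod_of_mem _ hj)
    (Ideal.subset_span ⟨j, by simpa using hjσ, rfl⟩)

/-- By maximality, σ ∪ {j} is a non-simplex for each j outside σ. Thus x_σ kills the kernel of F[K]
→ S/(X_j : j ∉ σ). -/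
theorem prod_X_mul_mem {σ : Finset (Fin m)} (hσ : σ ∈ K.maximalSimplices) {q : P}
    (hq : q ∈ Ideal.span (X '' ((σᶜ : Finset (Fin m)) : Set (Fin m)) : Set P)) :
    (∏ i ∈ σ, X i) * q ∈ K.stanleyReisnerIdeal F := by
  induction hq using Submodule.span_induction with
  | mem x hx =>
    obtain ⟨j, hj, rfl⟩ := hx
    have hj : j ∉ σ := by simpa using hj
    rw [mul_comm, ← Finset.prod_insert hj]
    refine Ideal.subset_span ⟨insert j σ, fun h => hj ?_, rfl⟩
    exact hσ.2 h (Finset.subset_insert j σ) (Finset.mem_insert_self j σ)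
  | zero => simp
  | add x y _ _ hx hy =>
    rw [mul_add]
    exact Ideal.add_mem _ hx hy
  | smul p x _ hx =>
    rw [smul_eq_mul, mul_left_comm]
    exact Ideal.mul_mem_left _ _ hx

theorem choose_le_length_tor {σ : Finset (Fin m)} (hσ : σ ∈ K.maximalSimplices)
    {A : ModuleCat.{u} P} (hA : Module.length P A = 1)
    (h₀ : ∀ j ∉ σ, ∀ a : A, (X j : P) • a = 0) (h₁ : ∀ a : A, (∏ i ∈ σ, X i : P) • a = a) (i : ℕ) :
    ((m - σ.card).choose i : ℕ∞) ≤
      Module.length P (tor i (K.stanleyReisnerModule F) A) := by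
  have hle := stanleyReisnerIdeal_le F hσ.1
  have hlen := length_tor_quotient_span_X hA σᶜ (fun j hj => h₀ j (by simpa using hj)) i
  rw [Finset.card_compl, Fintype.card_fin] at hlen
  rw [← hlen]
  let g : K.StanleyReisnerRing F →ₗ[P] _ := Submodule.factor hle
  have hg : Function.Surjective g := Submodule.factor_surjective hle
  cases i with
  | zero =>
    exact Module.length_le_of_surjective _ (torMap_zero_surjective (f := ModuleCat.ofHom g) hg A)
  | succ i =>
    have hS := shortComplexOfLinear_shortExact g.exact_subtype_ker_map
      (Submodule.injective_subtype _) hg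
    obtain ⟨δ, hδ, -⟩ := exists_connecting hS i A
    refine Module.length_le_of_surjective (torMap (i + 1) (ModuleCat.ofHom g) A).hom
      fun x => (hδ x).1 ?_
    -- On the Tor of the kernel, x_σ acts as 0 through the first argument and as 1 through `A`, so
    -- the connecting map is zero.
    have hs₀ : (∏ i ∈ σ, X i : P) • δ x = 0 := by
      refine smul_tor_eq_zero_of_left ?_ (δ x)
      rintro ⟨y, hy⟩
      obtain ⟨q, rfl⟩ := Submodule.mkQ_surjective _ y
      have hy : Submodule.Quotient.mk q = 0 := hy
      rw [Submodule.Quotient.mk_eq_zero] at hy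
      exact Subtype.ext ((Submodule.Quotient.mk_eq_zero _).2 (prod_X_mul_mem F hσ hy))
    have hs₁ : ((∏ i ∈ σ, X i : P) - 1) • δ x = 0 :=
      smul_tor_eq_zero_of_right (fun a => by rw [sub_smul, h₁, one_smul, sub_self]) (δ x)
    rw [sub_smul, hs₀, one_smul, zero_sub, neg_eq_zero] at hs₁
    exact hs₁

theorem smul_trivialModule_eq_zero (r : P) (hr : r ∈ idealOfVars (Fin m) F)
    (a : trivialModule m F) : r • a = 0 := by
  rw [mem_idealOfVars_iff] at hr
  change (constantCoeff r * (show F from a) : F) = 0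
  rw [hr, zero_mul]

theorem length_trivialModule : Module.length P (trivialModule m F) = 1 :=
  length_restrictScalars_field (constantCoeff : P →+* F) fun c => ⟨C c, constantCoeff_C _ c⟩

variable (K)

/-- The variables kill Tor(–, F), so a polynomial acts on it through its constant term, and length
over the polynomial ring equals dimension over F. -/
theorem bettiNumber_eq_length (i : ℕ) : K.bettiNumber F i =
    Module.length P (tor i (K.stanleyReisnerModule F) (trivialModule m F)) := by
  have h (r : P) (hr : r ∈ idealOfVars (Fin m) F)
      (t : tor i (K.stanleyReisnerModule F) (trivialModule m F)) : r • t = 0 :=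
    smul_tor_eq_zero_of_right (smul_trivialModule_eq_zero F r hr) t
  rw [bettiNumber, ← Module.length_eq_rank]
  let : Module P (K.torSpace F i) :=
    inferInstanceAs (Module P (tor i (K.stanleyReisnerModule F) (trivialModule m F)))
  refine (length_eq_of_smul_eq (V := K.torSpace F i) constantCoeff
    (fun c => ⟨C c, constantCoeff_C _ c⟩) fun p t => ?_).symm
  change p • t = (C (constantCoeff p) : P) • t
  rw [← sub_eq_zero, ← sub_smul]
  exact h _ (by simp [mem_idealOfVars_iff]) t

variable {K}

theorem choose_le_bettiNumber {σ : Finset (Fin m)} (hσ : σ ∈ K.maximalSimplices) (i : ℕ) :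
    ((m - σ.card).choose i : ℕ∞) ≤ K.bettiNumber F i := by
  classical
  -- At this point the variables outside σ vanish and x_σ takes the value 1.
  let a : Fin m → F := fun i => if i ∈ σ then 1 else 0
  have hA := length_evalModule a
  refine (choose_le_length_tor F hσ hA (fun j hj x => ?_) (fun x => ?_) i).trans ?_
  · rw [smul_evalModule, eval_X, show a j = 0 from if_neg hj, zero_mul]
    rfl
  · rw [smul_evalModule, map_prod, Finset.prod_eq_one, one_mul]
    intro i hi
    rw [eval_X]
    exact if_pos hi
  · rw [bettiNumber_eq_length]
    exact GradedStructure.length_tor_le hA.le (length_trivialModule F).ge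
      (smul_trivialModule_eq_zero F) i _ (K.stanleyReisnerGrading F)

end AbstractSimplicialComplex

/-! ### Equality of the Betti numbers and the main theorem -/

theorem ENat.eq_choose_of_tsum_eq {b : ℕ → ℕ∞} {n : ℕ} (hb : ∀ i, (n.choose i : ℕ∞) ≤ b i)
    (h : ∑' i, b i = 2 ^ n) (i : ℕ) : b i = n.choose i := by
  have hsum (s : Finset ℕ) : ∑ i ∈ s, b i ≤ 2 ^ n :=
    h ▸ Summable.sum_le_tsum s (fun _ _ => zero_le)
      ⟨_, tendsto_atTop_iSup fun _ _ h => Finset.sum_le_sum_of_subset h⟩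
  -- Finiteness is needed first: cancellation in the comparison of sums fails in `ℕ∞`.
  have htop (i : ℕ) : b i ≠ ⊤ := fun hi => by
    have := hsum {i}
    rw [Finset.sum_singleton, hi, top_le_iff] at this
    exact absurd this (by exact_mod_cast ENat.natCast_ne_top (2 ^ n))
  lift b to ℕ → ℕ using htop
  beta_reduce at hb hsum ⊢
  norm_cast at hb hsum ⊢
  -- The range is long enough to contain both the whole n-th row of Pascal's triangle and the index
  -- `i`.
  have hN : ∑ k ∈ Finset.range (n + 1 + i), n.choose k = 2 ^ n := by
    rw [← Nat.sum_range_choose n]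
    refine (Finset.sum_subset (Finset.range_mono (by omega)) fun k _ hk => ?_).symm
    exact Nat.choose_eq_zero_of_lt (by simpa using hk)
  have heq := (Finset.sum_eq_sum_iff_of_le (s := Finset.range (n + 1 + i)) fun k _ => hb k).1
    (le_antisymm (Finset.sum_le_sum fun k _ => hb k) (hN ▸ hsum _))
  exact (heq i (Finset.mem_range.2 (by omega))).symm

end

theorem corollary1p1 {F : Type*} [Field F] {m : ℕ} (K : AbstractSimplicialComplex (Fin m))
    (hK : K.IsWeaklyTight F) :
    (∀ i : ℕ, (i : ℤ) ≤ (m : ℤ) - K.mdim - 1 →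
      K.bettiNumber F i = (((m : ℤ) - K.mdim - 1).toNat.choose i : ℕ)) ∧
    K.pdim F = (((m : ℤ) - K.mdim - 1).toNat : ℕ) := by
  obtain ⟨σ, hσ, hd⟩ := K.mdim_mem
  have hn : ((m : ℤ) - K.mdim - 1).toNat = m - σ.card := by
    have := card_finset_fin_le σ
    omega
  have hb := ENat.eq_choose_of_tsum_eq (AbstractSimplicialComplex.choose_le_bettiNumber F hσ)
    (hn ▸ hK)
  rw [hn]
  refine ⟨fun i _ => hb i, ?_⟩
  simp only [AbstractSimplicialComplex.bettiNumber_eq_length] at hb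
  refine le_antisymm ?_ ?_
  -- Upper bound: with n = m - |σ|, Tor_{n+1} has length binom(n, n + 1) = 0.
  · refine (projectiveDimension_le_iff _ _).2 ?_
    refine MvPolynomial.GradedStructure.hasProjectiveDimensionLT_of_subsingleton_tor
      (AbstractSimplicialComplex.length_trivialModule F).ge
      (AbstractSimplicialComplex.smul_trivialModule_eq_zero F) _ _ (K.stanleyReisnerGrading F) ?_
    rw [← Module.length_eq_zero_iff (R := MvPolynomial (Fin m) F)]
    refine (hb _).trans ?_
    simp
  -- Lower bound: Tor_n has length binom(n, n) = 1, but projective dimension below n would make it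
  -- vanish.
  · refine (projectiveDimension_ge_iff _ _).2 fun h => ?_
    have h1 := ModuleTor.subsingleton_tor_of_hasProjectiveDimensionLT
      (AbstractSimplicialComplex.trivialModule m F) _ _ h
    have h2 := hb (m - σ.card)
    rw [Module.length_eq_zero] at h2
    simp at h2
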